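/- **Maps.** A $C^r$ generalized interval exchange transformation with gaps (g-GIET) on $d$ intervals is a map $S:I^t\to I^b$, where $I^t=\bigsqcup_{\alpha\in\mathcal A}I^t_\alpha$ and $I^b=\bigsqcup_{\alpha\in\mathcal A}I^b_\alpha$ are disjoint unions of $d=|\mathcal A|$ non-empty right-open subintervals of $[0,1)$ (top and bottom intervals) and each $S|_{I^t_\alpha}$ is an orientation preserving bijection onto $I^b_\alpha$ that extends to a $C^r$-diffeomorphism between the closures. The complements of $I^t$, $I^b$ form the top and bottom gaps. If $I^t=I^b=[0,1)$, $S$ is a GIET. **Orbits.** Let $T$ be a GIET and $R\subset[0,1)$ a finite union of right-open intervals; $T|_R:R\to T(R)$ is a partially defined map. The orbit of $x\in R$ under $T|_R$ consists of all forward and backward iterates of $x$ that are defined. It is *regular* if it is contained in $R\cap T(R)$, *periodic* if it is regular and finite, *transient* if it leaves $R$ in the future and $T(R)$ in the past, and *non-trivially recurrent* if it is regular and each of its points is an accumulation point both of its forward and of its backward orbit. *Recurrent* means periodic or non-trivially recurrent. A *quasiminimal* is the closure in $R$ of a non-trivially recurrent orbit. $R$ is a *domain of recurrence* if no orbit of $T|_R$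 is transient. A domain of recurrence $R$ is - a *periodic domain* if $T|_R$ has a periodic orbit, possibly at an endpoint (that is, $T|_R$, or its left-open version obtained by extending the branches continuously to the right endpoints of the intervals, has a periodic orbit), and all recurrent orbits of $T|_R$ are periodic of the same period; - a *quasiminimal domain* if $T|_R$ has a unique quasiminimal and all its recurrent orbits are non-trivially recurrent. **Rauzy–Veech induction.** Let $S$ be a g-GIET on $d\ge1$ intervals with rightmost top interval $I^t_{a}=[l^t,r^t)$ and rightmost bottom interval $I^b_{b}=[l^b,r^b)$. If $a=b$ and $r^t=r^b$, $S$ ends in a *cylinder* and no step is made. Otherwise one step replaces $S$ by its first return map to $[0,\lambda)$, with $\lambda=\max(l^t,l^b)$ if $r^t=r^b$ or if $\max(l^t,l^b)\ge\min(r^t,r^b)$, and $\lambda=\min(r^t,r^b)$ otherwise. Labels: - $r^t=r^b$, $l^t<l^b$: $a$ wins, $b$ loses; $I^t_a$ becomes $[l^t,l^b)$ and on $I^t_b$ the map becomes $S^2$. - $r^t=r^b$, $l^b<l^t$: $b$ wins, $a$ loses; $I^b_b$ becomes $[l^b,l^t)$, and the part of the old $I^t_b$ mapped to $[l^t,r^t)$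 gets the label $a$ and the map $S^2$. - $r^t=r^b$, $l^t=l^b$: nobody wins; $a$ is removed and on $I^t_b$ the map becomes $S^2$. - $r^t\ne r^b$, $\max(l^t,l^b)<\min(r^t,r^b)$: the interval ($I^t_a$ if $r^t>r^b$, $I^b_b$ if $r^b>r^t$) wins against a gap and is cut at $\lambda$. - $r^t\ne r^b$, $\max(l^t,l^b)\ge\min(r^t,r^b)$: the letter $a$ (if $r^t>r^b$), respectively $b$ (if $r^b>r^t$), loses against a gap and is removed. An iterate $S^{(N)}$ of an infinite sequence of steps is *RV-stable* if no letter is removed from step $N$ on, and each letter, from step $N$ on, wins never or infinitely often and loses never or infinitely often. **Decomposition.** The renormalization scheme applied to a g-GIET $S$ iterates the induction. If all intervals get removed, it ends without output. If some $S^{(n)}$ ends in a cylinder with label $a$, it outputs the restriction of $S^{(n)}$ to $I^t_a$ and restarts with the restriction of $S^{(n)}$ to the other intervals. If the induction never stops, one chooses $N$ with $S^{(N)}$ RV-stable, outputs the restriction of $S^{(N)}$ to the set of intervals whose letters win infinitely often, and restarts with the restriction to the other letters, unless the right endpoints of the rightmost top intervals of $S^{(n)}$ tend to $0$, in which case the scheme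 ends. Starting from a GIET $T$, let $T_i:E_i\to T_i(E_i)$, $1\le i\le k$, be the outputs. On each interval $I$ of $E_i$, $T_i$ is an iterate $T^{n_I}$, $n_I\ge1$, with $I,T(I),\dots,T^{n_I-1}(I)$ pairwise disjoint; let $R_i=\bigcup_{I}\bigcup_{0\le j<n_I}T^j(I)$ be the union of these towers. The sets $R_1,\dots,R_k$ are the domains of a decomposition of $T$ (the remaining part of $[0,1)$ being $D=[0,1)\setminus\bigcup_iR_i$). **Theorem.** Let $T:[0,1)\to[0,1)$ be a $C^r$ GIET with $d$ intervals. Then $T$ has a decomposition of this kind, and for every such decomposition, if $p$ denotes the number of its periodic domains and $q$ the number of its quasiminimal domains, then $$q\le\left\lfloor\frac{d-p}{2}\right\rfloor .$$ -/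

import Mathlib

open Set Filter Topology

/-! ### Partial dynamics

`F : ℝ → ℝ` and `J : Set ℝ` encode the partially defined map `F|_J : J → F '' J`; the complement of
`J` consists of the top gaps, the complement of `F '' J` of the bottom gaps. In all uses below `F` is
injective on `J`. -/

namespace PartialDyn

/-- Domain of definition of the `n`-th iterate of `F|_J` (everything for `n = 0`). -/
def iterDom (F : ℝ → ℝ) (J : Set ℝ) (n : ℕ) : Set ℝ :=
  {x | ∀ i < n, F^[i] x ∈ J}

/-- Forward orbit of `x`, including `x`. -/
def fwdOrbit (F : ℝ → ℝ) (J : Set ℝ) (x : ℝ) : Set ℝ :=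
  {y | ∃ n, x ∈ iterDom F J n ∧ F^[n] x = y}

/-- Backward orbit of `x`, including `x`. -/
def bwdOrbit (F : ℝ → ℝ) (J : Set ℝ) (x : ℝ) : Set ℝ :=
  {y | ∃ n, y ∈ iterDom F J n ∧ F^[n] y = x}

/-- Full orbit of `x`. -/
def orbit (F : ℝ → ℝ) (J : Set ℝ) (x : ℝ) : Set ℝ :=
  fwdOrbit F J x ∪ bwdOrbit F J x

/-- The orbit stays in the domain and in the image of `F|_J`. -/
def IsRegular (F : ℝ → ℝ) (J : Set ℝ) (x : ℝ) : Prop :=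
  orbit F J x ⊆ J ∩ F '' J

/-- Regular and finite orbit. -/
def IsPeriodic (F : ℝ → ℝ) (J : Set ℝ) (x : ℝ) : Prop :=
  IsRegular F J x ∧ (orbit F J x).Finite

/-- The orbit leaves the domain in the future through a top gap and in the past through a bottom
gap. -/
def IsTransient (F : ℝ → ℝ) (J : Set ℝ) (x : ℝ) : Prop :=
  (∃ y ∈ fwdOrbit F J x, y ∉ J) ∧ (∃ y ∈ bwdOrbit F J x, y ∉ F '' J)

/-- `J` contains no transient orbit of `F|_J`. -/
def IsDomainOfRecurrence (F : ℝ → ℝ) (J : Set ℝ) : Prop :=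
  ∀ x ∈ J, ¬ IsTransient F J x

/-- The orbit of `x` is a non-trivially recurrent orbit: it is regular, and each of its points is an
accumulation point of its own forward orbit and of its own backward orbit. -/
def IsNontriviallyRecurrent (F : ℝ → ℝ) (J : Set ℝ) (x : ℝ) : Prop :=
  IsRegular F J x ∧
    ∀ y ∈ orbit F J x, AccPt y (𝓟 (fwdOrbit F J y)) ∧ AccPt y (𝓟 (bwdOrbit F J y))

/-- Recurrent orbits are the periodic (trivially recurrent) and the non-trivially recurrent ones. -/
def IsRecurrent (F : ℝ → ℝ) (J : Set ℝ) (x : ℝ) : Prop :=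
  IsPeriodic F J x ∨ IsNontriviallyRecurrent F J x

/-- A quasiminimal: the closure in `J` of a non-trivially recurrent orbit. -/
def IsQuasiminimal (F : ℝ → ℝ) (J Ω : Set ℝ) : Prop :=
  ∃ x ∈ J, IsNontriviallyRecurrent F J x ∧ Ω = closure (orbit F J x) ∩ J

end PartialDyn

/-! ### Generalized interval exchange maps with gaps -/

/-- Data of an interval exchange map with gaps, labelled by a finite set `letters`: top intervals
`[tl α, tr α)`, bottom intervals `[bl α, br α)`, branches `f α` from top to bottom and inverse
branches `g α`. Only the values at `α ∈ letters`, and those of the branches on the closed intervals,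
are meaningful. -/
structure GapMap (ι : Type*) where
  letters : Finset ι
  tl : ι → ℝ
  tr : ι → ℝ
  bl : ι → ℝ
  br : ι → ℝ
  f : ι → ℝ → ℝ
  g : ι → ℝ → ℝ

namespace GapMap

variable {ι : Type*}

/-- The union `I^t` of the top intervals. -/
def topSet (S : GapMap ι) : Set ℝ := ⋃ α ∈ S.letters, Ico (S.tl α) (S.tr α)

/-- The union `I^b` of the bottom intervals. -/
def botSet (S : GapMap ι) : Set ℝ := ⋃ α ∈ S.letters, Ico (S.bl α) (S.br α)

/-- `S` is a `C^r` generalized interval exchange transformation with gaps: disjoint non-empty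
right-open intervals in `[0,1)`, and every branch is an orientation preserving `C^r`-diffeomorphism
between the closures of its top and its bottom interval. -/
structure IsGGIET (r : ℕ∞) (S : GapMap ι) : Prop where
  top_lt : ∀ α ∈ S.letters, S.tl α < S.tr α
  top_subset : ∀ α ∈ S.letters, Ico (S.tl α) (S.tr α) ⊆ Ico 0 1
  top_disjoint : ∀ α ∈ S.letters, ∀ β ∈ S.letters, α ≠ β →
    Disjoint (Ico (S.tl α) (S.tr α)) (Ico (S.tl β) (S.tr β))
  bot_lt : ∀ α ∈ S.letters, S.bl α < S.br α
  bot_subset : ∀ α ∈ S.letters, Ico (S.bl α) (S.br α) ⊆ Ico 0 1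
  bot_disjoint : ∀ α ∈ S.letters, ∀ β ∈ S.letters, α ≠ β →
    Disjoint (Ico (S.bl α) (S.br α)) (Ico (S.bl β) (S.br β))
  strictMonoOn : ∀ α ∈ S.letters, StrictMonoOn (S.f α) (Icc (S.tl α) (S.tr α))
  mapsTo : ∀ α ∈ S.letters,
    MapsTo (S.f α) (Icc (S.tl α) (S.tr α)) (Icc (S.bl α) (S.br α))
  mapsTo_inv : ∀ α ∈ S.letters,
    MapsTo (S.g α) (Icc (S.bl α) (S.br α)) (Icc (S.tl α) (S.tr α))
  invOn : ∀ α ∈ S.letters,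
    InvOn (S.g α) (S.f α) (Icc (S.tl α) (S.tr α)) (Icc (S.bl α) (S.br α))
  contDiffOn : ∀ α ∈ S.letters, ContDiffOn ℝ r (S.f α) (Icc (S.tl α) (S.tr α))
  contDiffOn_inv : ∀ α ∈ S.letters, ContDiffOn ℝ r (S.g α) (Icc (S.bl α) (S.br α))

/-- A generalized interval exchange transformation: no gaps. -/
structure IsGIET (r : ℕ∞) (S : GapMap ι) : Prop extends IsGGIET r S where
  topSet_eq : S.topSet = Ico 0 1
  botSet_eq : S.botSet = Ico 0 1

open Classical in
/-- The map `I^t → I^b`, extended by the identity outside `I^t`. -/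
noncomputable def toFun (S : GapMap ι) (x : ℝ) : ℝ :=
  if h : ∃ α ∈ S.letters, x ∈ Ico (S.tl α) (S.tr α) then S.f h.choose x else x

open Classical in
/-- The associated left-open map, defined on the intervals `(tl α, tr α]` through the continuous
extensions of the branches. -/
noncomputable def leftFun (S : GapMap ι) (x : ℝ) : ℝ :=
  if h : ∃ α ∈ S.letters, x ∈ Ioc (S.tl α) (S.tr α) then S.f h.choose x else x

/-- The restriction of `S` to the intervals with labels in `E`. -/
def restrict (S : GapMap ι) (E : Finset ι) : GapMap ι := { S with letters := E }

/-! ### Periodic and quasiminimal domains -/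

/-- For a finite disjoint union `R` of intervals `[c,d)`, the union of the intervals `(c,d]`. -/
def leftOpen (R : Set ℝ) : Set ℝ := {x | ∃ y < x, Ioo y x ⊆ R}

/-- `T|_R` has a periodic orbit, possibly at an endpoint: a periodic orbit of `T|_R`, or one of the
left-open map associated with `T|_R`. (A periodic orbit of the latter that meets no right endpoint
of an interval is also a periodic orbit of `T|_R`.) -/
def HasPeriodicOrbit (T : GapMap ι) (R : Set ℝ) : Prop :=
  (∃ x ∈ R, PartialDyn.IsPeriodic T.toFun R x) ∨
    ∃ x ∈ leftOpen R, PartialDyn.IsPeriodic T.leftFun (leftOpen R) x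

/-- `R` is a periodic domain of `T`: a domain of recurrence such that `T|_R` has a periodic orbit,
possibly at an endpoint, and all its recurrent orbits are periodic, of the same period. -/
def IsPeriodicDomain (T : GapMap ι) (R : Set ℝ) : Prop :=
  PartialDyn.IsDomainOfRecurrence T.toFun R ∧ T.HasPeriodicOrbit R ∧
    ∃ m : ℕ, ∀ x ∈ R, PartialDyn.IsRecurrent T.toFun R x →
      PartialDyn.IsPeriodic T.toFun R x ∧ (PartialDyn.orbit T.toFun R x).ncard = m

/-- `R` is a quasiminimal domain of `T`: a domain of recurrence such that `T|_R` has a unique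
quasiminimal and all its recurrent orbits are non-trivially recurrent. -/
def IsQuasiminimalDomain (T : GapMap ι) (R : Set ℝ) : Prop :=
  PartialDyn.IsDomainOfRecurrence T.toFun R ∧
    (∃! Ω : Set ℝ, PartialDyn.IsQuasiminimal T.toFun R Ω) ∧
    ∀ x ∈ R, PartialDyn.IsRecurrent T.toFun R x →
      PartialDyn.IsNontriviallyRecurrent T.toFun R x

/-! ### Rauzy–Veech induction with gaps -/

/-- `a` labels the rightmost top interval. -/
def IsTopLast (S : GapMap ι) (a : ι) : Prop :=
  a ∈ S.letters ∧ ∀ β ∈ S.letters, S.tr β ≤ S.tr a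

/-- `b` labels the rightmost bottom interval. -/
def IsBotLast (S : GapMap ι) (b : ι) : Prop :=
  b ∈ S.letters ∧ ∀ β ∈ S.letters, S.br β ≤ S.br b

variable [DecidableEq ι]

/-- First return map to `[0, bl b)` when the top interval `a` wins against the bottom interval `b`:
`a` keeps its part left of `bl b`, and on `b` the map becomes the second iterate. -/
def topWins (S : GapMap ι) (a b : ι) : GapMap ι where
  letters := S.letters
  tl := S.tl
  tr := Function.update S.tr a (S.bl b)
  bl := Function.update S.bl b (S.f a (S.bl b))
  br := Function.update (Function.update S.br b (S.br a)) a (S.f a (S.bl b))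
  f := Function.update S.f b (S.f a ∘ S.f b)
  g := Function.update S.g b (S.g b ∘ S.g a)

/-- First return map to `[0, tl a)` when the bottom interval `b` wins against the top interval `a`:
the top interval of `b` is cut at the preimage of `tl a`, the right part gets the label `a`, and
there the map becomes the second iterate. -/
def botWins (S : GapMap ι) (a b : ι) : GapMap ι where
  letters := S.letters
  tl := Function.update S.tl a (S.g b (S.tl a))
  tr := Function.update (Function.update S.tr a (S.tr b)) b (S.g b (S.tl a))
  bl := S.bl
  br := Function.update S.br b (S.tl a)
  f := Function.update S.f a (S.f a ∘ S.f b)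
  g := Function.update S.g a (S.g b ∘ S.g a)

/-- First return map to `[0, tl a)` when `tl a = bl b` and neither interval wins: `a` disappears,
and on `b` the map becomes the second iterate. -/
def noneWins (S : GapMap ι) (a b : ι) : GapMap ι where
  letters := S.letters.erase a
  tl := S.tl
  tr := S.tr
  bl := Function.update S.bl b (S.bl a)
  br := Function.update S.br b (S.br a)
  f := Function.update S.f b (S.f a ∘ S.f b)
  g := Function.update S.g b (S.g b ∘ S.g a)

/-- The top interval `a` is cut at `c`. -/
def cutTop (S : GapMap ι) (a : ι) (c : ℝ) : GapMap ι :=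
  { S with tr := Function.update S.tr a c, br := Function.update S.br a (S.f a c) }

/-- The bottom interval `b` is cut at `c`. -/
def cutBot (S : GapMap ι) (b : ι) (c : ℝ) : GapMap ι :=
  { S with br := Function.update S.br b c, tr := Function.update S.tr b (S.g b c) }

/-- `S.RVStep w l S'`: one elementary step of Rauzy–Veech induction leads from `S` to `S'`; `w` and
`l` are the labels of the winning and of the losing interval (`none` if there is no such interval,
in particular if the winner or the loser is a gap). No step is made from a cylinder whose top and
bottom right endpoints agree, since the renormalization scheme stops there. -/
inductive RVStep (S : GapMap ι) : Option ι → Option ι → GapMap ι → Prop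
  | top_wins (a b : ι) (ha : S.IsTopLast a) (hb : S.IsBotLast b) (hab : a ≠ b)
      (hr : S.tr a = S.br b) (hl : S.tl a < S.bl b) :
      RVStep S (some a) (some b) (S.topWins a b)
  | bot_wins (a b : ι) (ha : S.IsTopLast a) (hb : S.IsBotLast b) (hab : a ≠ b)
      (hr : S.tr a = S.br b) (hl : S.bl b < S.tl a) :
      RVStep S (some b) (some a) (S.botWins a b)
  | none_wins (a b : ι) (ha : S.IsTopLast a) (hb : S.IsBotLast b) (hab : a ≠ b)
      (hr : S.tr a = S.br b) (hl : S.tl a = S.bl b) :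
      RVStep S none none (S.noneWins a b)
  | top_wins_gap (a b : ι) (ha : S.IsTopLast a) (hb : S.IsBotLast b)
      (hr : S.br b < S.tr a) (hl : S.tl a < S.br b) :
      RVStep S (some a) none (S.cutTop a (S.br b))
  | bot_wins_gap (a b : ι) (ha : S.IsTopLast a) (hb : S.IsBotLast b)
      (hr : S.tr a < S.br b) (hl : S.bl b < S.tr a) :
      RVStep S (some b) none (S.cutBot b (S.tr a))
  | bot_gap_wins (a b : ι) (ha : S.IsTopLast a) (hb : S.IsBotLast b)
      (hr : S.br b < S.tr a) (hl : S.br b ≤ S.tl a) :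
      RVStep S none (some a) (S.restrict (S.letters.erase a))
  | top_gap_wins (a b : ι) (ha : S.IsTopLast a) (hb : S.IsBotLast b)
      (hr : S.tr a < S.br b) (hl : S.tr a ≤ S.bl b) :
      RVStep S none (some b) (S.restrict (S.letters.erase b))

/-- `S'` is obtained from `S` by finitely many (possibly zero) steps of the induction. -/
def RVReach : GapMap ι → GapMap ι → Prop :=
  Relation.ReflTransGen fun S S' => ∃ w l, S.RVStep w l S'

/-- The rightmost top and the rightmost bottom interval have the same label and the same right
endpoint. -/
def IsCylinder (S : GapMap ι) (a : ι) : Prop :=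
  S.IsTopLast a ∧ S.IsBotLast a ∧ S.tr a = S.br a

/-- The infinite sequence of iterates of `s 0` under the induction, with winners `w n` and losers
`l n` of the step from `s n` to `s (n + 1)`. -/
def IsRVOrbit (s : ℕ → GapMap ι) (w l : ℕ → Option ι) : Prop :=
  ∀ n, (s n).RVStep (w n) (l n) (s (n + 1))

/-- `s N` is RV-stable: from `N` on no interval is lost, and each letter wins never or infinitely
often, and loses never or infinitely often. -/
def IsRVStable (s : ℕ → GapMap ι) (w l : ℕ → Option ι) (N : ℕ) : Prop :=
  (∀ n ≥ N, (s n).letters = (s N).letters) ∧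
    ∀ α ∈ (s N).letters,
      ((∀ n ≥ N, w n ≠ some α) ∨ ∃ᶠ n in atTop, w n = some α) ∧
      ((∀ n ≥ N, l n ≠ some α) ∨ ∃ᶠ n in atTop, l n = some α)

/-- The right endpoint of the rightmost top interval. -/
noncomputable def topEnd (S : GapMap ι) : ℝ := sSup (S.tr '' S.letters)

/-! ### The renormalization scheme and the decomposition -/

/-- `Scheme S L`: starting from `S`, the renormalization scheme can output the list `L` of base maps
`T_i : E_i^t → E_i^b`.
* If the induction removes all intervals, there is no output.
* If it reaches a cylinder with equal right endpoints, the cylinder is the output, and the scheme is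
  restarted with the remaining intervals.
* If it goes on forever, one takes an RV-stable iterate; the output is its restriction to the letters
  that win infinitely often, and the scheme is restarted with the remaining letters, unless the
  right endpoints tend to `0`, in which case it stops. -/
inductive Scheme : GapMap ι → List (GapMap ι) → Prop
  | trivial (S S' : GapMap ι) (h : RVReach S S') (h0 : S'.letters = ∅) : Scheme S []
  | cylinder (S S' : GapMap ι) (a : ι) (L : List (GapMap ι)) (h : RVReach S S')
      (ha : S'.IsCylinder a) (hL : Scheme (S'.restrict (S'.letters.erase a)) L) :
      Scheme S (S'.restrict {a} :: L)
  | finish (s : ℕ → GapMap ι) (w l : ℕ → Option ι) (N : ℕ) (E : Finset ι)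
      (hs : IsRVOrbit s w l) (hN : IsRVStable s w l N)
      (hE : ∀ α, α ∈ E ↔ α ∈ (s N).letters ∧ ∃ᶠ n in atTop, w n = some α)
      (hlim : Tendsto (fun n => (s n).topEnd) atTop (𝓝 0)) :
      Scheme (s 0) [(s N).restrict E]
  | restart (s : ℕ → GapMap ι) (w l : ℕ → Option ι) (N : ℕ) (E : Finset ι) (L : List (GapMap ι))
      (hs : IsRVOrbit s w l) (hN : IsRVStable s w l N)
      (hE : ∀ α, α ∈ E ↔ α ∈ (s N).letters ∧ ∃ᶠ n in atTop, w n = some α)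
      (hlim : ¬ Tendsto (fun n => (s n).topEnd) atTop (𝓝 0))
      (hL : Scheme ((s N).restrict ((s N).letters \ E)) L) :
      Scheme (s 0) ((s N).restrict E :: L)

/-- `T` has a tower representation over `B` with heights `n`: over each top interval of `B` the
floors are pairwise disjoint and contained in the domain of `T`, and `B` is the iterate `T^(n α)`
there. -/
def IsTowerRep (T B : GapMap ι) (n : ι → ℕ) : Prop :=
  ∀ α ∈ B.letters, 0 < n α ∧
    (∀ j < n α, T.toFun^[j] '' Ico (B.tl α) (B.tr α) ⊆ T.topSet) ∧
    (∀ i < n α, ∀ j < n α, i ≠ j →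
      Disjoint (T.toFun^[i] '' Ico (B.tl α) (B.tr α)) (T.toFun^[j] '' Ico (B.tl α) (B.tr α))) ∧
    ∀ x ∈ Ico (B.tl α) (B.tr α), B.f α x = T.toFun^[n α] x

/-- The union of the towers over the top intervals of `B`. -/
def rep (T B : GapMap ι) (n : ι → ℕ) : Set ℝ :=
  ⋃ α ∈ B.letters, ⋃ j ∈ Finset.range (n α), T.toFun^[j] '' Ico (B.tl α) (B.tr α)

/-- The sets in the list `L` are the domains `R_1, …, R_k` of a decomposition of `T` produced by the
renormalization scheme: `R_i` is the tower representation of `T` over the `i`-th output. -/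
def IsDecomposition (T : GapMap ι) (L : List (Set ℝ)) : Prop :=
  ∃ B : List (GapMap ι), Scheme T B ∧
    List.Forall₂ (fun B R => ∃ n, IsTowerRep T B n ∧ R = rep T B n) B L

/-- Number of periodic domains among the sets in `L`. -/
noncomputable def numPeriodic (T : GapMap ι) (L : List (Set ℝ)) : ℕ :=
  Nat.card {i : Fin L.length // T.IsPeriodicDomain (L.get i)}

/-- Number of quasiminimal domains among the sets in `L`. -/
noncomputable def numQuasiminimal (T : GapMap ι) (L : List (Set ℝ)) : ℕ :=
  Nat.card {i : Fin L.length // T.IsQuasiminimalDomain (L.get i)}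

end GapMap

/-! The bound amounts to `2q + p ≤ d`, which is a count of letters. No step creates a letter, and
after an output the scheme restarts with letters outside it, so the outputs use at most `d` letters
in total (`Scheme.sum_card_letters_le`). A periodic domain is nonempty, hence costs at least one
letter; a quasiminimal domain costs at least two (`two_le_card_letters`); no domain is of both
kinds.

Two letters are needed because a domain with one letter is a single tower of height `k` over an
interval. A regular orbit returns to the base under the increasing map `T^k`, so its returns form a
monotone sequence: it cannot accumulate at its own points (`not_isNontriviallyRecurrent_of_tower`).

The link between outputs and `T` is the invariant `HasTowers`: branches are increasing iterates of
`T` and the towers over the top intervals are disjoint. Each step stacks one tower on another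
(`HasTowers.stack`) or shrinks or drops bases (`HasTowers.shrink`). It also makes every output a
tower representation, so existence of a decomposition reduces to termination of the scheme
(`exists_scheme`). -/

/-! ### Monotone branches -/

/-- `f` is a strictly increasing map of `[a, b]` onto `[c, d]` with right inverse `g`. -/
structure IsBranch (a b c d : ℝ) (f g : ℝ → ℝ) : Prop where
  -- Degenerate intervals are allowed, so that cutting at an endpoint still yields branches.
  le : a ≤ b
  strictMonoOn : StrictMonoOn f (Icc a b)
  map_left : f a = c
  map_right : f b = d
  mapsTo_inv : MapsTo g (Icc c d) (Icc a b)
  rightInv : ∀ y ∈ Icc c d, f (g y) = y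

namespace IsBranch

variable {a b c d x : ℝ} {f g : ℝ → ℝ}

theorem mapsTo (h : IsBranch a b c d f g) : MapsTo f (Icc a b) (Icc c d) := fun _ hx =>
  ⟨h.map_left ▸ h.strictMonoOn.monotoneOn ⟨le_rfl, h.le⟩ hx hx.1,
    h.map_right ▸ h.strictMonoOn.monotoneOn hx ⟨h.le, le_rfl⟩ hx.2⟩

theorem lt_right (h : IsBranch a b c d f g) (hx : x ∈ Ico a b) : f x < d :=
  h.map_right ▸ h.strictMonoOn ⟨hx.1, hx.2.le⟩ ⟨h.le, le_rfl⟩ hx.2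

theorem mapsTo_Ico (h : IsBranch a b c d f g) : MapsTo f (Ico a b) (Ico c d) := fun _ hx =>
  ⟨(h.mapsTo ⟨hx.1, hx.2.le⟩).1, h.lt_right hx⟩

theorem cutRight (h : IsBranch a b c d f g) (hx : x ∈ Icc a b) : IsBranch a x c (f x) f g where
  le := hx.1
  strictMonoOn := h.strictMonoOn.mono (Icc_subset_Icc_right hx.2)
  map_left := h.map_left
  map_right := rfl
  mapsTo_inv y hy := by
    have hy' : y ∈ Icc c d := ⟨hy.1, hy.2.trans (h.mapsTo hx).2⟩
    have hg := h.mapsTo_inv hy'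
    refine ⟨hg.1, (h.strictMonoOn.le_iff_le hg hx).1 ?_⟩
    rw [h.rightInv y hy']
    exact hy.2
  rightInv y hy := h.rightInv y ⟨hy.1, hy.2.trans (h.mapsTo hx).2⟩

theorem cutLeft (h : IsBranch a b c d f g) (hx : x ∈ Icc a b) : IsBranch x b (f x) d f g where
  le := hx.2
  strictMonoOn := h.strictMonoOn.mono (Icc_subset_Icc_left hx.1)
  map_left := rfl
  map_right := h.map_right
  mapsTo_inv y hy := by
    have hy' : y ∈ Icc c d := ⟨(h.mapsTo hx).1.trans hy.1, hy.2⟩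
    have hg := h.mapsTo_inv hy'
    refine ⟨(h.strictMonoOn.le_iff_le hx hg).1 ?_, hg.2⟩
    rw [h.rightInv y hy']
    exact hy.1
  rightInv y hy := h.rightInv y ⟨(h.mapsTo hx).1.trans hy.1, hy.2⟩

theorem comp {p q : ℝ} {f' g' : ℝ → ℝ} (h : IsBranch a b c d f g) (h' : IsBranch c d p q f' g') :
    IsBranch a b p q (f' ∘ f) (g ∘ g') where
  le := h.le
  strictMonoOn := h'.strictMonoOn.comp h.strictMonoOn h.mapsTo
  map_left := by simp [h.map_left, h'.map_left]
  map_right := by simp [h.map_right, h'.map_right]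
  mapsTo_inv := h.mapsTo_inv.comp h'.mapsTo_inv
  rightInv y hy := by
    simp [h.rightInv _ (h'.mapsTo_inv hy), h'.rightInv y hy]

end IsBranch

/-! ### Towers over a single monotone branch -/

namespace PartialDyn

variable {F : ℝ → ℝ} {J : Set ℝ} {x : ℝ}

theorem IsRegular.iterate_mem (h : IsRegular F J x) (m : ℕ) : F^[m] x ∈ J := by
  induction m using Nat.strong_induction_on with
  | _ m ih => exact (h (Or.inl ⟨m, ih, rfl⟩)).1

theorem not_accPt_of_finite {s : Set ℝ} (hs : s.Finite) : ¬ AccPt x (𝓟 s) := by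
  intro h
  rw [accPt_iff_nhds] at h
  obtain ⟨y, ⟨hy, hys⟩, hne⟩ := h (s \ {x})ᶜ
    ((hs.subset sdiff_subset).isClosed.isOpen_compl.mem_nhds (by simp))
  exact hy ⟨hys, hne⟩

/-- If `F` is injective on an invariant set `X` containing `Ico l r`, the first `k` images of
`Ico l r` are pairwise disjoint, and `F^[k]` is increasing on `Ico l r`, then the tower over
`Ico l r` of height `k` contains no non-trivially recurrent orbit. -/
theorem not_isNontriviallyRecurrent_of_tower {X : Set ℝ} {l r : ℝ} {k : ℕ}
    (hinj : InjOn F X) (hmaps : MapsTo F X X) (hI : Ico l r ⊆ X)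
    (hk : 0 < k)
    (hdisj : ∀ i < k, ∀ j < k, i ≠ j → Disjoint (F^[i] '' Ico l r) (F^[j] '' Ico l r))
    (hmono : StrictMonoOn F^[k] (Ico l r))
    (hJ : J = ⋃ j ∈ Finset.range k, F^[j] '' Ico l r) (hx : x ∈ J) :
    ¬ IsNontriviallyRecurrent F J x := by
  rintro ⟨hreg, hacc⟩
  have memJ : ∀ {z}, z ∈ J ↔ ∃ j < k, ∃ y ∈ Ico l r, F^[j] y = z := by
    intro z; simp [hJ, mem_iUnion]
  -- `y` is the point of the base below `x`; recurrence is tested on its returns to the base.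
  obtain ⟨j, hj, y, hy, hyx⟩ := memJ.1 hx
  have hyJ : ∀ m, F^[m] y ∈ J := by
    intro m
    rcases lt_or_ge m k with h | h
    · exact memJ.2 ⟨m, h, y, hy, rfl⟩
    · have := hreg.iterate_mem (m - j)
      rwa [← hyx, ← Function.iterate_add_apply, Nat.sub_add_cancel (by omega)] at this
  have hyorb : y ∈ orbit F J x := Or.inr ⟨j, fun i _ => hyJ i, hyx⟩
  have hGorb : F^[k] y ∈ orbit F J x := by
    refine Or.inl ⟨k - j, fun i _ => hreg.iterate_mem i, ?_⟩
    rw [← hyx, ← Function.iterate_add_apply, Nat.sub_add_cancel hj.le]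
  have zero_floor : ∀ i < k, ∀ z ∈ Ico l r, F^[i] z ∈ Ico l r → i = 0 := by
    intro i hi z hz hz'
    by_contra h0
    exact disjoint_left.1 (hdisj i hi 0 hk h0) ⟨z, hz, rfl⟩ ⟨_, hz', rfl⟩
  have injIter : ∀ i, InjOn F^[i] X := fun i => hinj.iterate hmaps i
  -- If `F^[k] z` were on a floor `i > 0` above `u`, cancelling `F^[i]` would give `u = F^[k - i]
  -- z`, a return to the base before time `k`.
  have back : ∀ z ∈ Ico l r, F^[k] z ∈ J → F^[k] z ∈ Ico l r := by
    intro z hz hzJ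
    obtain ⟨i, hi, u, hu, huz⟩ := memJ.1 hzJ
    have h1 : F^[i] u = F^[i] (F^[k - i] z) := by
      rw [huz, ← Function.iterate_add_apply, Nat.add_sub_cancel' hi.le]
    have h2 := injIter i (hI hu) ((hmaps.iterate _) (hI hz)) h1
    rcases Nat.eq_zero_or_pos i with h0 | h0
    · subst h0; simpa [← huz] using hu
    · have := zero_floor (k - i) (by omega) z hz (h2 ▸ hu)
      omega
  have iter_eq : ∀ m z, (F^[k])^[m] z = F^[k * m] z := fun m z => by
    rw [Function.iterate_mul]
  have hG : ∀ m, (F^[k])^[m] y ∈ Ico l r := by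
    intro m
    induction m with
    | zero => exact hy
    | succ m ih =>
      rw [Function.iterate_succ_apply']
      refine back _ ih ?_
      rw [← Function.iterate_succ_apply' (F^[k]), iter_eq]
      exact hyJ _
  -- Disjointness of the floors allows visits to the base only at multiples of `k`.
  have fwd : ∀ p, (∀ m, (F^[k])^[m] p ∈ Ico l r) → ∀ q ∈ fwdOrbit F J p, q ∈ Ico l r →
      ∃ m, q = (F^[k])^[m] p := by
    rintro p hp q ⟨m, -, rfl⟩ hq
    have hm : F^[m] p = F^[m % k] ((F^[k])^[m / k] p) := by
      rw [iter_eq, ← Function.iterate_add_apply, Nat.mod_add_div]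
    rw [hm] at hq ⊢
    have h0 := zero_floor _ (Nat.mod_lt _ hk) _ (hp _) hq
    exact ⟨m / k, by rw [h0]; rfl⟩
  have hsucc : ∀ m, (F^[k])^[m + 1] y = (F^[k])^[m] (F^[k] y) := fun m =>
    Function.iterate_succ_apply _ m y
  rcases lt_trichotomy y (F^[k] y) with hlt | heq | hgt
  · have hs : StrictMono fun m => (F^[k])^[m] y := by
      refine strictMono_nat_of_lt_succ fun m => ?_
      induction m with
      | zero => exact hlt
      | succ m ih =>
        rw [Function.iterate_succ_apply' _ m, Function.iterate_succ_apply' _ (m + 1)]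
        exact hmono (hG m) (hG (m + 1)) ih
    -- The point `F^[k] y` is used instead of `y`, since `y` may be the endpoint `l`, which is not
    -- interior to the base. The forward orbit of `F^[k] y` meets this neighbourhood only in `F^[k]
    -- y`.
    have hU : Ioo l ((F^[k])^[2] y) ∈ 𝓝 (F^[k] y) :=
      isOpen_Ioo.mem_nhds ⟨hy.1.trans_lt hlt, hs (show 1 < 2 by omega)⟩
    obtain ⟨q, ⟨hq, hqo⟩, hne⟩ := accPt_iff_nhds.1 (hacc _ hGorb).1 _ hU
    obtain ⟨m, rfl⟩ := fwd _ (fun m => hsucc m ▸ hG (m + 1)) q hqo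
      ⟨hq.1.le, hq.2.trans (hG 2).2⟩
    rw [← hsucc] at hq hne
    have h2 : m + 1 < 2 := hs.lt_iff_lt.1 hq.2
    obtain rfl : m = 0 := by omega
    exact hne rfl
  · refine not_accPt_of_finite ?_ (hacc y hyorb).1
    refine ((Set.finite_Iio k).image fun i => F^[i] y).subset ?_
    rintro _ ⟨m, -, rfl⟩
    refine ⟨m % k, Nat.mod_lt _ hk, ?_⟩
    have hm : F^[m] y = F^[m % k] ((F^[k])^[m / k] y) := by
      rw [iter_eq, ← Function.iterate_add_apply, Nat.mod_add_div]
    rw [hm, Function.iterate_fixed heq.symm]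
  · have hs : StrictAnti fun m => (F^[k])^[m] y := by
      refine strictAnti_nat_of_succ_lt fun m => ?_
      induction m with
      | zero => exact hgt
      | succ m ih =>
        rw [Function.iterate_succ_apply' _ m, Function.iterate_succ_apply' _ (m + 1)]
        exact hmono (hG (m + 1)) (hG m) ih
    -- Here `y` is interior to the base, because `l ≤ F^[k] y < y`.
    have hU : Ioo (F^[k] y) r ∈ 𝓝 y := isOpen_Ioo.mem_nhds ⟨hgt, hy.2⟩
    obtain ⟨q, ⟨hq, hqo⟩, hne⟩ := accPt_iff_nhds.1 (hacc _ hyorb).1 _ hU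
    obtain ⟨m, rfl⟩ := fwd _ hG q hqo ⟨(hG 1).1.trans hq.1.le, hq.2⟩
    have h2 : m < 1 := hs.lt_iff_gt.1 hq.1
    obtain rfl : m = 0 := by omega
    exact hne rfl

end PartialDyn

namespace GapMap

variable {ι : Type*}

/-! ### The map of a generalized interval exchange -/

theorem IsGGIET.toFun_eq {r : ℕ∞} {S : GapMap ι} (h : S.IsGGIET r) {α : ι} (hα : α ∈ S.letters)
    {x : ℝ} (hx : x ∈ Ico (S.tl α) (S.tr α)) : S.toFun x = S.f α x := by
  have hex : ∃ α ∈ S.letters, x ∈ Ico (S.tl α) (S.tr α) := ⟨α, hα, hx⟩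
  rw [toFun, dif_pos hex]
  have hc := hex.choose_spec
  by_cases hne : hex.choose = α
  · rw [hne]
  · exact (disjoint_left.1 (h.top_disjoint _ hc.1 _ hα hne) hc.2 hx).elim

/-- Endpoints go to endpoints because the inverse branch provides preimages of `bl α` and `br α`,
and monotonicity compares these with `tl α` and `tr α`. -/
theorem IsGGIET.isBranch {r : ℕ∞} {S : GapMap ι} (h : S.IsGGIET r) {α : ι} (hα : α ∈ S.letters) :
    IsBranch (S.tl α) (S.tr α) (S.bl α) (S.br α) (S.f α) (S.g α) := by
  have hl := (h.top_lt α hα).le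
  have hb := (h.bot_lt α hα).le
  have hm := (h.strictMonoOn α hα).monotoneOn
  have hinv := (h.invOn α hα).2
  have hg := h.mapsTo_inv α hα
  have hf := h.mapsTo α hα
  refine ⟨hl, h.strictMonoOn α hα, le_antisymm ?_ (hf ⟨le_rfl, hl⟩).1,
    le_antisymm (hf ⟨hl, le_rfl⟩).2 ?_, hg, fun y hy => hinv hy⟩
  · have h0 : S.bl α ∈ Icc (S.bl α) (S.br α) := ⟨le_rfl, hb⟩
    have := hm ⟨le_rfl, hl⟩ (hg h0) (hg h0).1
    rwa [hinv h0] at this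
  · have h0 : S.br α ∈ Icc (S.bl α) (S.br α) := ⟨hb, le_rfl⟩
    have := hm (hg h0) ⟨hl, le_rfl⟩ (hg h0).2
    rwa [hinv h0] at this

theorem mem_topSet {S : GapMap ι} {x : ℝ} :
    x ∈ S.topSet ↔ ∃ α ∈ S.letters, x ∈ Ico (S.tl α) (S.tr α) := by
  simp only [topSet, mem_iUnion, exists_prop]

/-- Absence of top gaps enters here: bottom intervals lie in `[0,1)`, which is the whole domain. -/
theorem IsGIET.mapsTo_toFun {r : ℕ∞} {T : GapMap ι} (h : T.IsGIET r) :
    MapsTo T.toFun T.topSet T.topSet := by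
  intro x hx
  obtain ⟨α, hα, hx⟩ := mem_topSet.1 hx
  rw [h.toFun_eq hα hx, h.topSet_eq]
  exact h.bot_subset α hα ((h.isBranch hα).mapsTo_Ico hx)

theorem IsGGIET.injOn_toFun {r : ℕ∞} {T : GapMap ι} (h : T.IsGGIET r) :
    InjOn T.toFun T.topSet := by
  intro x hx y hy hxy
  obtain ⟨α, hα, hx⟩ := mem_topSet.1 hx
  obtain ⟨β, hβ, hy⟩ := mem_topSet.1 hy
  rw [h.toFun_eq hα hx, h.toFun_eq hβ hy] at hxy
  have hx' := (h.isBranch hα).mapsTo_Ico hx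
  have hy' := (h.isBranch hβ).mapsTo_Ico hy
  by_cases hne : α = β
  · subst hne
    exact (h.strictMonoOn α hα).injOn ⟨hx.1, hx.2.le⟩ ⟨hy.1, hy.2.le⟩ hxy
  · exact (disjoint_left.1 (h.bot_disjoint α hα β hβ hne) hx' (hxy ▸ hy')).elim

/-! ### Tower representations along the induction -/

/-- The branches of `S` are increasing and are iterates `F^[n α]`, and the towers of heights `n α`
over the top intervals, which lie in `X`, are pairwise disjoint: a point `F^[i] x` determines the
tower, the floor and the point `x` of the base. -/
structure HasTowers (F : ℝ → ℝ) (X : Set ℝ) (S : GapMap ι) (n : ι → ℕ) : Prop where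
  branch : ∀ α ∈ S.letters, IsBranch (S.tl α) (S.tr α) (S.bl α) (S.br α) (S.f α) (S.g α)
  pos : ∀ α ∈ S.letters, 0 < n α
  subset : ∀ α ∈ S.letters, Ico (S.tl α) (S.tr α) ⊆ X
  iterate : ∀ α ∈ S.letters, ∀ x ∈ Ico (S.tl α) (S.tr α), S.f α x = F^[n α] x
  inj : ∀ α ∈ S.letters, ∀ β ∈ S.letters, ∀ i < n α, ∀ j < n β,
    ∀ x ∈ Ico (S.tl α) (S.tr α), ∀ y ∈ Ico (S.tl β) (S.tr β),
      F^[i] x = F^[j] y → α = β ∧ i = j ∧ x = y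

theorem IsGGIET.hasTowers {r : ℕ∞} {T : GapMap ι} (h : T.IsGGIET r) :
    T.HasTowers T.toFun T.topSet fun _ => 1 where
  branch _ hα := h.isBranch hα
  pos _ _ := one_pos
  subset α hα _ hx := mem_topSet.2 ⟨α, hα, hx⟩
  iterate _ hα _ hx := (h.toFun_eq hα hx).symm
  inj α hα β hβ i hi j hj x hx y hy hxy := by
    obtain rfl : i = 0 := by omega
    obtain rfl : j = 0 := by omega
    replace hxy : x = y := hxy
    refine ⟨?_, rfl, hxy⟩
    by_contra hne
    exact disjoint_left.1 (h.top_disjoint α hα β hβ hne) hx (hxy ▸ hy)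

namespace HasTowers

variable {F : ℝ → ℝ} {X : Set ℝ} {S S' : GapMap ι} {n : ι → ℕ}

/-- Shrinking the top intervals and removing letters preserves towers. -/
theorem shrink (h : S.HasTowers F X n) (hL : S'.letters ⊆ S.letters)
    (hI : ∀ α ∈ S'.letters, Ico (S'.tl α) (S'.tr α) ⊆ Ico (S.tl α) (S.tr α))
    (hf : ∀ α ∈ S'.letters, S'.f α = S.f α)
    (hb : ∀ α ∈ S'.letters,
      IsBranch (S'.tl α) (S'.tr α) (S'.bl α) (S'.br α) (S'.f α) (S'.g α)) :
    S'.HasTowers F X n where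
  branch := hb
  pos α hα := h.pos α (hL hα)
  subset α hα := (hI α hα).trans (h.subset α (hL hα))
  iterate α hα x hx := by rw [hf α hα, h.iterate α (hL hα) x (hI α hα hx)]
  inj α hα β hβ i hi j hj x hx y hy hxy :=
    h.inj α (hL hα) β (hL hβ) i hi j hj x (hI α hα hx) y (hI β hβ hy) hxy

theorem restrict (h : S.HasTowers F X n) {E : Finset ι} (hE : E ⊆ S.letters) :
    (S.restrict E).HasTowers F X n :=
  h.shrink hE (fun _ _ => Subset.rfl) (fun _ _ => rfl) fun α hα => h.branch α (hE hα)

theorem isTowerRep {T B : GapMap ι} (h : B.HasTowers T.toFun T.topSet n)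
    (hT : MapsTo T.toFun T.topSet T.topSet) : IsTowerRep T B n := by
  intro α hα
  refine ⟨h.pos α hα, ?_, ?_, h.iterate α hα⟩
  · rintro j _ _ ⟨x, hx, rfl⟩
    exact hT.iterate j (h.subset α hα hx)
  · intro i hi j hj hij
    rw [disjoint_left]
    rintro _ ⟨x, hx, rfl⟩ ⟨y, hy, hxy⟩
    exact hij (h.inj α hα α hα i hi j hj x hx y hy hxy.symm).2.1

/-! ### Towers under the elementary steps of the induction. -/

variable [DecidableEq ι]

/-- Stacking the tower of `a` on a part of the tower of `b` gives a tower with label `c`. -/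
theorem stack (h : S.HasTowers F X n) {a b c : ι} (ha : a ∈ S.letters) (hb : b ∈ S.letters)
    (hab : a ≠ b) (hL : S'.letters ⊆ S.letters)
    (hI : ∀ α ∈ S'.letters, α ≠ c → Ico (S'.tl α) (S'.tr α) ⊆ Ico (S.tl α) (S.tr α))
    (hf : ∀ α ∈ S'.letters, α ≠ c → S'.f α = S.f α)
    (hbr : ∀ α ∈ S'.letters,
      IsBranch (S'.tl α) (S'.tr α) (S'.bl α) (S'.br α) (S'.f α) (S'.g α))
    (hcI : Ico (S'.tl c) (S'.tr c) ⊆ Ico (S.tl b) (S.tr b))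
    (hcf : S'.f c = S.f a ∘ S.f b)
    (hca : MapsTo (S.f b) (Ico (S'.tl c) (S'.tr c)) (Ico (S.tl a) (S.tr a)))
    -- These two conditions separate what remains of the towers of `b` and `a` from the stacked one.
    -- The label `c` is `b` in `topWins` and `noneWins`, and `a` in `botWins`, so in each case one
    -- of them is vacuous.
    (hbd : b ∈ S'.letters → b ≠ c →
      Disjoint (Ico (S'.tl b) (S'.tr b)) (Ico (S'.tl c) (S'.tr c)))
    (had : a ∈ S'.letters → a ≠ c →
      ∀ x ∈ Ico (S'.tl c) (S'.tr c), S.f b x ∉ Ico (S'.tl a) (S'.tr a)) :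
    S'.HasTowers F X (Function.update n c (n b + n a)) := by
  -- Floors below `n b` of the stacked tower lie in the old tower of `b`, the others in the old
  -- tower of `a`; splitting at `n b` reduces every coincidence to `h.inj`.
  have hup : ∀ x ∈ Ico (S'.tl c) (S'.tr c), ∀ i, n b ≤ i →
      F^[i] x = F^[i - n b] (S.f b x) := by
    intro x hx i hi
    rw [h.iterate b hb x (hcI hx), ← Function.iterate_add_apply, Nat.sub_add_cancel hi]
  have hcross : ∀ α ∈ S'.letters, α ≠ c → ∀ i < n α, ∀ j < n b + n a,
      ∀ x ∈ Ico (S'.tl α) (S'.tr α), ∀ y ∈ Ico (S'.tl c) (S'.tr c), F^[i] x ≠ F^[j] y := by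
    intro α hα hαc i hi j hj x hx y hy hxy
    rcases lt_or_ge j (n b) with hjb | hjb
    · obtain ⟨rfl, -, rfl⟩ :=
        h.inj α (hL hα) b hb i hi j hjb x (hI α hα hαc hx) y (hcI hy) hxy
      exact disjoint_left.1 (hbd hα hαc) hx hy
    · rw [hup y hy j hjb] at hxy
      obtain ⟨rfl, -, rfl⟩ :=
        h.inj α (hL hα) a ha i hi _ (by omega) x (hI α hα hαc hx) _ (hca hy) hxy
      exact had hα hαc y hy hx
  have hsame : ∀ i < n b + n a, ∀ j < n b + n a, ∀ x ∈ Ico (S'.tl c) (S'.tr c),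
      ∀ y ∈ Ico (S'.tl c) (S'.tr c), F^[i] x = F^[j] y → i = j ∧ x = y := by
    intro i hi j hj x hx y hy hxy
    rcases lt_or_ge i (n b) with hib | hib <;> rcases lt_or_ge j (n b) with hjb | hjb
    · exact (h.inj b hb b hb i hib j hjb x (hcI hx) y (hcI hy) hxy).2
    · rw [hup y hy j hjb] at hxy
      exact (hab (h.inj b hb a ha i hib _ (by omega) x (hcI hx) _ (hca hy) hxy).1.symm).elim
    · rw [hup x hx i hib] at hxy
      exact (hab (h.inj a ha b hb _ (by omega) j hjb _ (hca hx) y (hcI hy) hxy).1).elim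
    · rw [hup x hx i hib, hup y hy j hjb] at hxy
      obtain ⟨-, h1, h2⟩ :=
        h.inj a ha a ha _ (by omega) _ (by omega) _ (hca hx) _ (hca hy) hxy
      have hx' := hcI hx
      have hy' := hcI hy
      exact ⟨by omega, (h.branch b hb).strictMonoOn.injOn ⟨hx'.1, hx'.2.le⟩ ⟨hy'.1, hy'.2.le⟩ h2⟩
  refine ⟨hbr, fun α hα => ?_, fun α hα => ?_, fun α hα x hx => ?_, ?_⟩
  · rcases eq_or_ne α c with rfl | hαc
    · rw [Function.update_self]
      exact Nat.add_pos_left (h.pos b hb) _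
    · rw [Function.update_of_ne hαc]
      exact h.pos α (hL hα)
  · rcases eq_or_ne α c with rfl | hαc
    · exact hcI.trans (h.subset b hb)
    · exact (hI α hα hαc).trans (h.subset α (hL hα))
  · rcases eq_or_ne α c with rfl | hαc
    · rw [Function.update_self, hcf, Function.comp_apply, h.iterate a ha _ (hca hx),
        hup x hx _ (Nat.le_add_right _ _), Nat.add_sub_cancel_left]
    · rw [Function.update_of_ne hαc, hf α hα hαc, h.iterate α (hL hα) x (hI α hα hαc hx)]
  · intro α hα β hβ i hi j hj x hx y hy hxy
    rcases eq_or_ne α c with hαc | hαc <;> rcases eq_or_ne β c with hβc | hβc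
    · subst hαc hβc
      rw [Function.update_self] at hi hj
      exact ⟨rfl, hsame i hi j hj x hx y hy hxy⟩
    · subst hαc
      rw [Function.update_self] at hi
      rw [Function.update_of_ne hβc] at hj
      exact (hcross β hβ hβc j hj i hi y hy x hx hxy.symm).elim
    · subst hβc
      rw [Function.update_self] at hj
      rw [Function.update_of_ne hαc] at hi
      exact (hcross α hα hαc i hi j hj x hx y hy hxy).elim
    · rw [Function.update_of_ne hαc] at hi
      rw [Function.update_of_ne hβc] at hj
      exact h.inj α (hL hα) β (hL hβ) i hi j hj x (hI α hα hαc hx) y (hI β hβ hβc hy) hxy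

/-- The bottom interval of `b` lies inside the top interval of `a`, so the whole tower of `b`
continues into that of `a`. What `a` keeps is left of `bl b`, away from the image of `b`. -/
theorem topWins (h : S.HasTowers F X n) {a b : ι} (ha : a ∈ S.letters) (hb : b ∈ S.letters)
    (hab : a ≠ b) (hr : S.tr a = S.br b) (hl : S.tl a < S.bl b) :
    (S.topWins a b).HasTowers F X (Function.update n b (n b + n a)) := by
  have hA := h.branch a ha
  have hB := h.branch b hb
  have hc : S.bl b ∈ Icc (S.tl a) (S.tr a) :=
    ⟨hl.le, hr ▸ (hB.mapsTo ⟨le_rfl, hB.le⟩).1.trans (hB.mapsTo ⟨le_rfl, hB.le⟩).2⟩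
  refine h.stack ha hb hab Subset.rfl ?_ ?_ ?_ ?_ ?_ ?_ ?_ ?_
  · intro α _ _
    rcases eq_or_ne α a with rfl | hαa
    · simpa [GapMap.topWins] using Ico_subset_Ico_right hc.2
    · simp [GapMap.topWins, hαa]
  · intro α _ hαb
    simp [GapMap.topWins, hαb]
  · intro α hα
    rcases eq_or_ne α a with rfl | hαa
    · simpa [GapMap.topWins, hab] using hA.cutRight hc
    · rcases eq_or_ne α b with rfl | hαb
      · have := hA.cutLeft hc
        rw [hr] at this
        simpa [GapMap.topWins, hαa] using hB.comp this
      · simpa [GapMap.topWins, hαa, hαb] using h.branch α hα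
  · simp [GapMap.topWins, hab.symm]
  · simp [GapMap.topWins]
  · intro x hx
    have hx' : x ∈ Ico (S.tl b) (S.tr b) := by simpa [GapMap.topWins, hab.symm] using hx
    have := hB.mapsTo_Ico hx'
    exact ⟨hl.le.trans this.1, hr ▸ this.2⟩
  · exact fun _ hne => (hne rfl).elim
  · intro _ _ x hx hfx
    have hx' : x ∈ Ico (S.tl b) (S.tr b) := by simpa [GapMap.topWins, hab.symm] using hx
    have hlt : S.f b x < S.bl b := by simpa [GapMap.topWins] using hfx.2
    exact hlt.not_ge (hB.mapsTo_Ico hx').1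

/-- Only the part of the base of `b` to the right of `g b (tl a)` continues into the tower of `a`;
it takes the label `a`, and the part to the left keeps the label `b` and the old height. -/
theorem botWins (h : S.HasTowers F X n) {a b : ι} (ha : a ∈ S.letters) (hb : b ∈ S.letters)
    (hab : a ≠ b) (hr : S.tr a = S.br b) (hl : S.bl b < S.tl a) :
    (S.botWins a b).HasTowers F X (Function.update n a (n b + n a)) := by
  have hA := h.branch a ha
  have hB := h.branch b hb
  have hc : S.tl a ∈ Icc (S.bl b) (S.br b) := ⟨hl.le, hr ▸ hA.le⟩
  have hg := hB.mapsTo_inv hc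
  have hfg := hB.rightInv _ hc
  have hBl := hB.cutLeft hg
  have hBr := hB.cutRight hg
  rw [hfg] at hBl hBr
  rw [← hr] at hBl
  refine h.stack ha hb hab Subset.rfl ?_ ?_ ?_ ?_ ?_ ?_ ?_ ?_
  · intro α _ hαa
    rcases eq_or_ne α b with rfl | hαb
    · simpa [GapMap.botWins, hαa] using Ico_subset_Ico_right hg.2
    · simp [GapMap.botWins, hαa, hαb]
  · intro α _ hαa
    simp [GapMap.botWins, hαa]
  · intro α hα
    rcases eq_or_ne α a with rfl | hαa
    · simpa [GapMap.botWins, hab] using hBl.comp hA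
    · rcases eq_or_ne α b with rfl | hαb
      · simpa [GapMap.botWins, hαa] using hBr
      · simpa [GapMap.botWins, hαa, hαb] using h.branch α hα
  · simpa [GapMap.botWins, hab] using Ico_subset_Ico_left hg.1
  · simp [GapMap.botWins]
  · simpa [GapMap.botWins, hab] using hBl.mapsTo_Ico
  · intro _ _
    simp [GapMap.botWins, hab, hab.symm]
  · exact fun _ hne => (hne rfl).elim

theorem noneWins (h : S.HasTowers F X n) {a b : ι} (ha : a ∈ S.letters) (hb : b ∈ S.letters)
    (hab : a ≠ b) (hr : S.tr a = S.br b) (hl : S.tl a = S.bl b) :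
    (S.noneWins a b).HasTowers F X (Function.update n b (n b + n a)) := by
  have hA := h.branch a ha
  have hB := h.branch b hb
  rw [← hr, ← hl] at hB
  refine h.stack ha hb hab (Finset.erase_subset _ _) (fun _ _ _ => Subset.rfl) ?_ ?_ Subset.rfl
    ?_ hB.mapsTo_Ico ?_ ?_
  · intro α _ hαb
    simp [GapMap.noneWins, hαb]
  · intro α hα
    rcases eq_or_ne α b with rfl | hαb
    · simpa [GapMap.noneWins] using hB.comp hA
    · simpa [GapMap.noneWins, hαb] using h.branch α (Finset.mem_of_mem_erase hα)
  · simp [GapMap.noneWins]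
  · exact fun _ hne => (hne rfl).elim
  · exact fun ha' _ => (Finset.notMem_erase _ _ ha').elim

theorem cutTop (h : S.HasTowers F X n) {a : ι} {c : ℝ} (ha : a ∈ S.letters)
    (hc : c ∈ Icc (S.tl a) (S.tr a)) : (S.cutTop a c).HasTowers F X n := by
  refine h.shrink Subset.rfl ?_ (fun _ _ => rfl) ?_ <;> intro α hα <;>
    rcases eq_or_ne α a with rfl | hαa
  · simpa [GapMap.cutTop] using Ico_subset_Ico_right hc.2
  · simp [GapMap.cutTop, hαa]
  · simpa [GapMap.cutTop] using (h.branch α ha).cutRight hc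
  · simpa [GapMap.cutTop, hαa] using h.branch α hα

theorem cutBot (h : S.HasTowers F X n) {b : ι} {c : ℝ} (hb : b ∈ S.letters)
    (hc : c ∈ Icc (S.bl b) (S.br b)) : (S.cutBot b c).HasTowers F X n := by
  have hg := (h.branch b hb).mapsTo_inv hc
  have hcut := (h.branch b hb).cutRight hg
  rw [(h.branch b hb).rightInv _ hc] at hcut
  refine h.shrink Subset.rfl ?_ (fun _ _ => rfl) ?_ <;> intro α hα <;>
    rcases eq_or_ne α b with rfl | hαb
  · simpa [GapMap.cutBot] using Ico_subset_Ico_right hg.2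
  · simp [GapMap.cutBot, hαb]
  · simpa [GapMap.cutBot] using hcut
  · simpa [GapMap.cutBot, hαb] using h.branch α hα

theorem rvStep {w l : Option ι} (h : S.HasTowers F X n) (hs : S.RVStep w l S') :
    ∃ n', S'.HasTowers F X n' := by
  cases hs with
  | top_wins a b ha hb hab hr hl => exact ⟨_, h.topWins ha.1 hb.1 hab hr hl⟩
  | bot_wins a b ha hb hab hr hl => exact ⟨_, h.botWins ha.1 hb.1 hab hr hl⟩
  | none_wins a b ha hb hab hr hl => exact ⟨_, h.noneWins ha.1 hb.1 hab hr hl⟩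
  | top_wins_gap a b ha hb hr hl => exact ⟨_, h.cutTop ha.1 ⟨hl.le, hr.le⟩⟩
  | bot_wins_gap a b ha hb hr hl => exact ⟨_, h.cutBot hb.1 ⟨hl.le, hr.le⟩⟩
  | bot_gap_wins a b ha hb hr hl => exact ⟨_, h.restrict (Finset.erase_subset _ _)⟩
  | top_gap_wins a b ha hb hr hl => exact ⟨_, h.restrict (Finset.erase_subset _ _)⟩

theorem rvReach (h : S.HasTowers F X n) (hs : RVReach S S') : ∃ n', S'.HasTowers F X n' := by
  induction hs with
  | refl => exact ⟨n, h⟩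
  | tail _ hstep ih =>
    obtain ⟨_, hn⟩ := ih
    obtain ⟨_, _, hstep⟩ := hstep
    exact hn.rvStep hstep

end HasTowers

/-! ### Periodic and quasiminimal domains of tower representations -/

/-- The orbit generating the quasiminimal would be periodic, hence finite, and a finite set has no
accumulation points. -/
theorem IsPeriodicDomain.not_isQuasiminimalDomain {T : GapMap ι} {R : Set ℝ}
    (hp : T.IsPeriodicDomain R) : ¬ T.IsQuasiminimalDomain R := by
  rintro ⟨-, ⟨Ω, ⟨x, hx, hrec, -⟩, -⟩, -⟩
  obtain ⟨-, -, m, hm⟩ := hp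
  have hfin := (hm x hx (.inr hrec)).1.2
  exact PartialDyn.not_accPt_of_finite (hfin.subset subset_union_left)
    (hrec.2 x (.inl ⟨0, fun i hi => (Nat.not_lt_zero i hi).elim, rfl⟩)).1

theorem IsPeriodicDomain.nonempty {T : GapMap ι} {R : Set ℝ} (hp : T.IsPeriodicDomain R) :
    R.Nonempty := by
  rcases hp.2.1 with ⟨x, hx, -⟩ | ⟨x, ⟨y, hy, hsub⟩, -⟩
  · exact ⟨x, hx⟩
  · exact (nonempty_Ioo.2 hy).mono hsub

theorem letters_nonempty_of_rep_nonempty {T B : GapMap ι} {n : ι → ℕ} (h : (rep T B n).Nonempty) :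
    B.letters.Nonempty := by
  obtain ⟨x, hx⟩ := h
  simp only [rep, mem_iUnion, exists_prop] at hx
  obtain ⟨α, hα, -⟩ := hx
  exact ⟨α, hα⟩

/-- A quasiminimal domain is represented by at least two intervals. -/
theorem two_le_card_letters {r : ℕ∞} {T B : GapMap ι} {n m : ι → ℕ} (hT : T.IsGIET r)
    (hB : B.HasTowers T.toFun T.topSet m) (hn : IsTowerRep T B n)
    (hq : T.IsQuasiminimalDomain (rep T B n)) : 2 ≤ B.letters.card := by
  obtain ⟨-, ⟨Ω, ⟨x, hx, hrec, -⟩, -⟩, -⟩ := hq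
  have hpos := (letters_nonempty_of_rep_nonempty ⟨x, hx⟩).card_pos
  by_contra hlt
  obtain ⟨α, hα⟩ := Finset.card_eq_one.1 (show B.letters.card = 1 by omega)
  have hmem : α ∈ B.letters := by simp [hα]
  obtain ⟨hk, -, hdisj, hf⟩ := hn α hmem
  -- The heights `n` of the given representation need not be the heights `m`; from `hB` come only
  -- the monotonicity of the branch and the position of the base.
  refine PartialDyn.not_isNontriviallyRecurrent_of_tower hT.injOn_toFun hT.mapsTo_toFun
    (hB.subset α hmem) hk hdisj ?_ ?_ hx hrec
  · exact ((hB.branch α hmem).strictMonoOn.mono Ico_subset_Icc_self).congr fun x hx => hf x hx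
  · simp [rep, hα]

/-- Turns the counts of domains into sums that can be handled by induction along the list. -/
theorem natCard_get_eq_sum {β : Type*} (P : β → Prop) [DecidablePred P] (L : List β) :
    Nat.card {i : Fin L.length // P (L.get i)} = (L.map fun R => if P R then 1 else 0).sum := by
  rw [Nat.card_eq_fintype_card, Fintype.card_subtype, Finset.card_filter]
  exact Fin.sum_univ_fun_getElem L fun R => if P R then 1 else 0

/-! ### The renormalization scheme -/

theorem eventually_never_or_frequently (u : ℕ → Option ι) (α : ι) :
    ∀ᶠ N in atTop, (∀ n ≥ N, u n ≠ some α) ∨ ∃ᶠ n in atTop, u n = some α := by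
  by_cases h : ∃ᶠ n in atTop, u n = some α
  · exact .of_forall fun _ => .inr h
  · exact (eventually_forall_ge_atTop.2 (not_frequently.1 h)).mono fun _ => .inl

variable [DecidableEq ι]

/-! ### Letters, winners and infinite sequences of steps. -/

theorem RVStep.letters_subset {S S' : GapMap ι} {w l : Option ι} (h : S.RVStep w l S') :
    S'.letters ⊆ S.letters := by
  cases h <;> first | exact Subset.rfl | exact Finset.erase_subset _ _

theorem RVReach.letters_subset {S S' : GapMap ι} (h : RVReach S S') : S'.letters ⊆ S.letters := by
  induction h with
  | refl => exact Subset.rfl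
  | tail _ hstep ih =>
    obtain ⟨_, _, hstep⟩ := hstep
    exact hstep.letters_subset.trans ih

/-- A step that removes no letter has a winner. -/
theorem RVStep.exists_winner {S S' : GapMap ι} {w l : Option ι} (h : S.RVStep w l S')
    (hL : S'.letters = S.letters) : ∃ α ∈ S.letters, w = some α := by
  cases h with
  | top_wins a b ha hb => exact ⟨a, ha.1, rfl⟩
  | bot_wins a b ha hb => exact ⟨b, hb.1, rfl⟩
  | none_wins a b ha hb => exact (Finset.notMem_erase a S.letters (hL.symm.subset ha.1)).elim
  | top_wins_gap a b ha hb => exact ⟨a, ha.1, rfl⟩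
  | bot_wins_gap a b ha hb => exact ⟨b, hb.1, rfl⟩
  | bot_gap_wins a b ha hb => exact (Finset.notMem_erase a S.letters (hL.symm.subset ha.1)).elim
  | top_gap_wins a b ha hb => exact (Finset.notMem_erase b S.letters (hL.symm.subset hb.1)).elim

/-- The induction can be continued unless all letters are removed or a cylinder is reached. -/
theorem exists_rvStep {S : GapMap ι} (h0 : S.letters ≠ ∅) (hc : ∀ a, ¬ S.IsCylinder a) :
    ∃ w l S', S.RVStep w l S' := by
  have hne := Finset.nonempty_iff_ne_empty.2 h0
  obtain ⟨a, ha⟩ : ∃ a, S.IsTopLast a := S.letters.exists_max_image S.tr hne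
  obtain ⟨b, hb⟩ : ∃ b, S.IsBotLast b := S.letters.exists_max_image S.br hne
  rcases lt_trichotomy (S.tr a) (S.br b) with hr | hr | hr
  · rcases lt_or_ge (S.bl b) (S.tr a) with hl | hl
    · exact ⟨_, _, _, .bot_wins_gap a b ha hb hr hl⟩
    · exact ⟨_, _, _, .top_gap_wins a b ha hb hr hl⟩
  · have hab : a ≠ b := by
      rintro rfl
      exact hc a ⟨ha, hb, hr⟩
    rcases lt_trichotomy (S.tl a) (S.bl b) with hl | hl | hl
    · exact ⟨_, _, _, .top_wins a b ha hb hab hr hl⟩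
    · exact ⟨_, _, _, .none_wins a b ha hb hab hr hl⟩
    · exact ⟨_, _, _, .bot_wins a b ha hb hab hr hl⟩
  · rcases lt_or_ge (S.tl a) (S.br b) with hl | hl
    · exact ⟨_, _, _, .top_wins_gap a b ha hb hr hl⟩
    · exact ⟨_, _, _, .bot_gap_wins a b ha hb hr hl⟩

theorem exists_isRVOrbit {S : GapMap ι}
    (h : ∀ S', RVReach S S' → ∃ w l S'', S'.RVStep w l S'') :
    ∃ s w l, s 0 = S ∧ IsRVOrbit s w l := by
  choose w l next hnext using h
  -- Each term carries the proof that it is reachable, which is what allows the next choice.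
  let t : ℕ → {S' // RVReach S S'} := fun n =>
    Nat.rec ⟨S, .refl⟩ (fun _ S' => ⟨next S'.1 S'.2, S'.2.tail ⟨_, _, hnext S'.1 S'.2⟩⟩) n
  exact ⟨fun n => (t n).1, fun n => w _ (t n).2, fun n => l _ (t n).2, rfl,
    fun n => hnext _ (t n).2⟩

theorem IsRVOrbit.rvReach {s : ℕ → GapMap ι} {w l : ℕ → Option ι} (hs : IsRVOrbit s w l)
    (n : ℕ) : RVReach (s 0) (s n) := by
  induction n with
  | zero => exact .refl
  | succ n ih => exact ih.tail ⟨_, _, hs n⟩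

theorem IsRVOrbit.antitone_letters {s : ℕ → GapMap ι} {w l : ℕ → Option ι}
    (hs : IsRVOrbit s w l) : Antitone fun n => (s n).letters :=
  antitone_nat_of_succ_le fun n => (hs n).letters_subset

theorem IsRVOrbit.exists_isRVStable {s : ℕ → GapMap ι} {w l : ℕ → Option ι}
    (hs : IsRVOrbit s w l) : ∃ N, IsRVStable s w l N := by
  obtain ⟨M, hM⟩ : ∃ M, ∀ n ≥ M, (s n).letters = (s M).letters := by
    -- The letter sets decrease, so they are constant from an index of minimal cardinality on.
    let M := Function.argmin fun n => (s n).letters.card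
    exact ⟨M, fun n hn => Finset.eq_of_subset_of_card_le (hs.antitone_letters hn)
      (Function.argmin_le (fun n => (s n).letters.card) n)⟩
  have hev : ∀ᶠ N in atTop, ∀ α ∈ (s M).letters,
      ((∀ n ≥ N, w n ≠ some α) ∨ ∃ᶠ n in atTop, w n = some α) ∧
      ((∀ n ≥ N, l n ≠ some α) ∨ ∃ᶠ n in atTop, l n = some α) :=
    (Finset.eventually_all _).2 fun α _ =>
      (eventually_never_or_frequently w α).and (eventually_never_or_frequently l α)
  obtain ⟨N, hN, hMN⟩ := (hev.and (eventually_ge_atTop M)).exists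
  refine ⟨N, fun n hn => ?_, fun α hα => hN α (hM N hMN ▸ hα)⟩
  rw [hM N hMN, hM n (hMN.trans hn)]

/-- Pigeonhole: from `N` on every step has a winner in a fixed finite set. This makes the output
nonempty, so that a restart has fewer letters. -/
theorem IsRVOrbit.exists_frequently_winner {s : ℕ → GapMap ι} {w l : ℕ → Option ι} {N : ℕ}
    (hs : IsRVOrbit s w l) (hN : IsRVStable s w l N) :
    ∃ α ∈ (s N).letters, ∃ᶠ n in atTop, w n = some α := by
  by_contra! hcon
  have hev : ∀ᶠ n in atTop, ∀ α ∈ (s N).letters, w n ≠ some α :=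
    (Finset.eventually_all _).2 fun α hα => hcon α hα
  obtain ⟨n, hn, hNn⟩ := (hev.and (eventually_ge_atTop N)).exists
  obtain ⟨α, hα, hw⟩ := (hs n).exists_winner
    ((hN.1 (n + 1) (by omega)).trans (hN.1 n hNn).symm)
  exact hn α (hN.1 n hNn ▸ hα) hw

/-- Termination is by the number of letters: a restart loses the letter of the cylinder, or all
letters that win infinitely often. -/
theorem exists_scheme (S : GapMap ι) : ∃ L, Scheme S L := by
  induction hd : S.letters.card using Nat.strong_induction_on generalizing S with
  | _ d ih =>
    by_cases h0 : ∃ S', RVReach S S' ∧ S'.letters = ∅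
    · obtain ⟨S', h, h0⟩ := h0
      exact ⟨_, .trivial S S' h h0⟩
    by_cases hc : ∃ S' a, RVReach S S' ∧ S'.IsCylinder a
    · obtain ⟨S', a, h, ha⟩ := hc
      obtain ⟨L, hL⟩ := ih _ (hd ▸ (Finset.card_erase_lt_of_mem ha.1.1).trans_le
        (Finset.card_le_card h.letters_subset)) (S'.restrict (S'.letters.erase a)) rfl
      exact ⟨_, .cylinder S S' a L h ha hL⟩
    push Not at h0 hc
    obtain ⟨s, w, l, rfl, hs⟩ := exists_isRVOrbit fun S' h =>
      exists_rvStep (Finset.nonempty_iff_ne_empty.1 (h0 S' h)) fun a => hc S' a h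
    obtain ⟨N, hN⟩ := hs.exists_isRVStable
    classical
    let E := (s N).letters.filter fun α => ∃ᶠ n in atTop, w n = some α
    have hE : ∀ α, α ∈ E ↔ α ∈ (s N).letters ∧ ∃ᶠ n in atTop, w n = some α := fun α =>
      Finset.mem_filter
    by_cases hlim : Tendsto (fun n => (s n).topEnd) atTop (𝓝 0)
    · exact ⟨_, .finish s w l N E hs hN hE hlim⟩
    · obtain ⟨α, hα, hw⟩ := hs.exists_frequently_winner hN
      have hlt : ((s N).letters \ E).card < d := by
        refine hd ▸ (Finset.card_lt_card ?_).trans_le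
          (Finset.card_le_card (hs.rvReach N).letters_subset)
        exact Finset.sdiff_ssubset (Finset.filter_subset _ _) ⟨α, (hE α).2 ⟨hα, hw⟩⟩
      obtain ⟨L, hL⟩ := ih _ hlt ((s N).restrict ((s N).letters \ E)) rfl
      exact ⟨_, .restart s w l N E L hs hN hE hlim hL⟩

/-! ### Towers and letter counts along the scheme. -/

theorem Scheme.hasTowers {F : ℝ → ℝ} {X : Set ℝ} {S : GapMap ι} {L : List (GapMap ι)}
    (h : Scheme S L) (hS : ∃ n, S.HasTowers F X n) : ∀ B ∈ L, ∃ n, B.HasTowers F X n := by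
  induction h with
  | trivial => simp
  | cylinder S S' a L h ha hL ih =>
    obtain ⟨n, hn⟩ := hS
    obtain ⟨n', hn'⟩ := hn.rvReach h
    exact List.forall_mem_cons.2
      ⟨⟨n', hn'.restrict (Finset.singleton_subset_iff.2 ha.1.1)⟩,
        ih ⟨n', hn'.restrict (Finset.erase_subset _ _)⟩⟩
  | finish s w l N E hs hN hE hlim =>
    obtain ⟨n, hn⟩ := hS
    obtain ⟨n', hn'⟩ := hn.rvReach (hs.rvReach N)
    exact List.forall_mem_cons.2 ⟨⟨n', hn'.restrict fun α hα => ((hE α).1 hα).1⟩, by simp⟩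
  | restart s w l N E L hs hN hE hlim hL ih =>
    obtain ⟨n, hn⟩ := hS
    obtain ⟨n', hn'⟩ := hn.rvReach (hs.rvReach N)
    exact List.forall_mem_cons.2 ⟨⟨n', hn'.restrict fun α hα => ((hE α).1 hα).1⟩,
      ih ⟨n', hn'.restrict Finset.sdiff_subset⟩⟩

/-- The outputs of the scheme use pairwise disjoint sets of letters. -/
theorem Scheme.sum_card_letters_le {S : GapMap ι} {L : List (GapMap ι)} (h : Scheme S L) :
    (L.map fun B => B.letters.card).sum ≤ S.letters.card := by
  induction h with
  | trivial => simp
  | cylinder S S' a L h ha hL ih =>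
    have h1 := Finset.card_erase_add_one ha.1.1
    have h2 := Finset.card_le_card h.letters_subset
    simp only [restrict, List.map_cons, List.sum_cons, Finset.card_singleton] at ih ⊢
    omega
  | finish s w l N E hs hN hE hlim =>
    have hsub : E ⊆ (s N).letters := fun α hα => ((hE α).1 hα).1
    simpa [restrict] using Finset.card_le_card (hsub.trans (hs.rvReach N).letters_subset)
  | restart s w l N E L hs hN hE hlim hL ih =>
    have hsub : E ⊆ (s N).letters := fun α hα => ((hE α).1 hα).1
    have h1 := Finset.card_sdiff_add_card_eq_card hsub
    have h2 := Finset.card_le_card (hs.rvReach N).letters_subset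
    simp only [restrict, List.map_cons, List.sum_cons] at ih ⊢
    omega

theorem IsGIET.exists_isDecomposition {r : ℕ∞} {T : GapMap ι} (hT : T.IsGIET r) :
    ∃ L, T.IsDecomposition L := by
  obtain ⟨B, hB⟩ := exists_scheme T
  have h := hB.hasTowers ⟨_, hT.hasTowers⟩
  suffices ∃ L, List.Forall₂ (fun B R => ∃ n, IsTowerRep T B n ∧ R = rep T B n) B L from
    this.imp fun L hL => ⟨B, hB, hL⟩
  clear hB
  induction B with
  | nil => exact ⟨[], .nil⟩
  | cons A B ih =>
    rw [List.forall_mem_cons] at h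
    obtain ⟨⟨n, hn⟩, h⟩ := h
    obtain ⟨L, hL⟩ := ih h
    exact ⟨_, .cons ⟨n, hn.isTowerRep hT.mapsTo_toFun, rfl⟩ hL⟩

/-! ### The bound -/

/-- The comparison is made output by output: each domain contributes 2, 1 or 0 on the left and at
least as many letters on the right. -/
theorem IsGIET.two_mul_numQuasiminimal_add_numPeriodic_le {r : ℕ∞} {T : GapMap ι}
    (hT : T.IsGIET r) {L : List (Set ℝ)} (hL : T.IsDecomposition L) :
    2 * T.numQuasiminimal L + T.numPeriodic L ≤ T.letters.card := by
  classical
  obtain ⟨B, hB, hBL⟩ := hL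
  refine le_trans ?_ hB.sum_card_letters_le
  rw [numQuasiminimal, numPeriodic, natCard_get_eq_sum, natCard_get_eq_sum]
  have h := hB.hasTowers ⟨_, hT.hasTowers⟩
  -- The tail of the list need not be an output of the scheme from `T`; only the towers `h` pass to
  -- it.
  clear hB
  induction hBL with
  | nil => simp
  | @cons A R B L hAR _ ih =>
    rw [List.forall_mem_cons] at h
    obtain ⟨⟨m, hm⟩, h⟩ := h
    specialize ih h
    obtain ⟨n, hn, rfl⟩ := hAR
    simp only [List.map_cons, List.sum_cons]
    split_ifs with hq hp hp
    · exact (hp.not_isQuasiminimalDomain hq).elim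
    · have := two_le_card_letters hT hm hn hq
      omega
    · have := (letters_nonempty_of_rep_nonempty hp.nonempty).card_pos
      omega
    · omega

end GapMap

theorem theorem1p3 {ι : Type*} [DecidableEq ι] (r : ℕ∞) (T : GapMap ι) (hT : T.IsGIET r) :
    (∃ L : List (Set ℝ), T.IsDecomposition L) ∧
      ∀ L : List (Set ℝ), T.IsDecomposition L →
        (T.numQuasiminimal L : ℤ) ≤ ⌊((T.letters.card : ℝ) - (T.numPeriodic L : ℝ)) / 2⌋ := by
  refine ⟨hT.exists_isDecomposition, fun L hL => Int.le_floor.2 ?_⟩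
  have h : (2 * T.numQuasiminimal L + T.numPeriodic L : ℝ) ≤ T.letters.card := by
    exact_mod_cast hT.two_mul_numQuasiminimal_add_numPeriodic_le hL
  push_cast
  linarith
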